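/- Let $n$ and $m$ be natural numbers, let $N$ be a $C^\infty$ manifold of dimension $n$ (Hausdorff, second countable, without boundary), let $U$ be an open subset of $\mathbb{R}^m$, let $f : N \to U$ be a $C^\infty$ immersion, and let $F : U \to \mathbb{R}$ be a $C^\infty$ function. For a linear map $\pi : \mathbb{R}^m \to \mathbb{R}$ put $F_\pi = F + \pi|_U$. Identify the space $\mathcal{L}(\mathbb{R}^m,\mathbb{R})$ of linear maps $\mathbb{R}^m\to\mathbb{R}$ with $\mathbb{R}^m$ by means of the coefficients with respect to the standard basis. Then there exists a subset $\Sigma \subset \mathcal{L}(\mathbb{R}^m,\mathbb{R})$ of Lebesgue measure zero such that for every $\pi \in \mathcal{L}(\mathbb{R}^m,\mathbb{R}) \setminus \Sigma$ the function $F_\pi \circ f : N \to \mathbb{R}$ is a Morse function, that is, a $C^\infty$ function such that at every point $q \in N$ with $d(F_\pi \circ f)_q = 0$ the Hessian of $F_\pi \circ f$ in local coordinates around $q$ is a nondegenerate bilinear form. -/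

import Mathlib

open scoped Manifold ContDiff

noncomputable section

/-- The natural identification of the space of linear maps `ℝ^m → ℝ` with `ℝ^m`, sending a linear
map to its coefficients `(α_1, …, α_m)` with respect to the standard basis. -/
def coeffEquiv (m : ℕ) : (EuclideanSpace ℝ (Fin m) →ₗ[ℝ] ℝ) ≃ₗ[ℝ] (Fin m → ℝ) :=
  ((EuclideanSpace.basisFun (Fin m) ℝ).toBasis.constr ℝ).symm

theorem coeffEquiv_apply {m : ℕ} (π : EuclideanSpace ℝ (Fin m) →ₗ[ℝ] ℝ) (j : Fin m) :
    coeffEquiv m π j = π (EuclideanSpace.single j 1) := by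
  simp [coeffEquiv, Module.Basis.constr]

theorem coeffEquiv_symm_apply {m : ℕ} (α : Fin m → ℝ) (x : EuclideanSpace ℝ (Fin m)) :
    (coeffEquiv m).symm α x = ∑ j, α j * x j := by
  simp [coeffEquiv, Module.Basis.constr_apply_fintype, mul_comm]

/-- A set of linear maps `ℝ^m → ℝ` has Lebesgue measure zero, under the natural identification
with `ℝ^m`. -/
def HasLebesgueMeasureZero {m : ℕ} (S : Set (EuclideanSpace ℝ (Fin m) →ₗ[ℝ] ℝ)) : Prop :=
  MeasureTheory.volume (coeffEquiv m '' S) = 0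

/-- The linearly perturbed function `F_π = F + π`, with `π` restricted to `U`. -/
def linearPerturbation {m : ℕ} {U : TopologicalSpace.Opens (EuclideanSpace ℝ (Fin m))}
    (F : U → ℝ) (π : EuclideanSpace ℝ (Fin m) →ₗ[ℝ] ℝ) : U → ℝ :=
  fun x => F x + π (x : EuclideanSpace ℝ (Fin m))

section Morse

variable {n : ℕ} {N : Type*} [TopologicalSpace N] [ChartedSpace (EuclideanSpace ℝ (Fin n)) N]

/-- `q` is a singular (critical) point of `g`: the differential `dg_q : T_q N → ℝ` vanishes. -/
def IsSingularPoint (g : N → ℝ) (q : N) : Prop :=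
  mfderiv (𝓡 n) 𝓘(ℝ, ℝ) g q = 0

/-- The Hessian of `g` at `q` in the chart of `N` at `q`: the second derivative of
`g ∘ φ⁻¹` at `φ q`, where `φ` is the chart, as a bilinear form on `ℝ^n`. Whether it is
nondegenerate at a singular point does not depend on the chart. -/
def chartHessian (g : N → ℝ) (q : N) :
    EuclideanSpace ℝ (Fin n) →L[ℝ] EuclideanSpace ℝ (Fin n) →L[ℝ] ℝ :=
  fderiv ℝ (fderiv ℝ (g ∘ (chartAt (EuclideanSpace ℝ (Fin n)) q).symm))
    (chartAt (EuclideanSpace ℝ (Fin n)) q q)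

/-- The Hessian of `g` at `q` is a nondegenerate (symmetric) bilinear form. -/
def HasNondegenerateHessian (g : N → ℝ) (q : N) : Prop :=
  ∀ v : EuclideanSpace ℝ (Fin n),
    (∀ w : EuclideanSpace ℝ (Fin n), chartHessian g q v w = 0) → v = 0

variable (n) in
/-- A Morse function on the `n`-dimensional manifold `N`: a smooth function all of whose singular
points are nondegenerate. -/
structure IsMorseFunction (g : N → ℝ) : Prop where
  contMDiff : ContMDiff (𝓡 n) 𝓘(ℝ, ℝ) ∞ g
  nondegenerate : ∀ q : N, IsSingularPoint (n := n) g q → HasNondegenerateHessian (n := n) g q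

end Morse

end

/-!
In a chart around a point of `N` write `φ = F ∘ f` and let `g` be the immersion `f`, viewed as a map
into `ℝ^m`. For a coefficient vector `a`, the function `φ + ⟨a, g⟩` has derivative
`G x + T x a`, where `G = Dφ` and `T x a = ⟨a, Dg x ·⟩`. A point is critical when this vanishes, and
the critical point is degenerate when the derivative in `x` of `G x + T x a` has a kernel. Since `g`
is an immersion, `T x` is surjective. It therefore suffices to know that, for an affine family of
equations `G x + T x a = 0` with as many unknowns as equations and with `T x` surjective, almost
every parameter `a` has only nondegenerate zeros
(`exists_nhds_measure_degenerate_zeros_eq_zero`).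

To see this, split the parameter space as `P = range S ⊕ ker (T x₀)`, with `S` a linear right
inverse of `T x₀`. For `x` near `x₀` the map `T x ∘ S` is invertible, so the equation can be solved
for the `range S`-component of `a` in terms of `x` and the other component `γ`. The solution set is
thus parametrised by pairs `(x, γ)`, a space of the same dimension as `P`, and a degenerate zero
gives a kernel vector of the derivative of the parametrisation `Ψ : (x, γ) ↦ a`. The equidimensional
case of Sard's theorem, `addHaar_image_eq_zero_of_det_fderivWithin_eq_zero`, says that the
corresponding values `a` form a null set.

Globally, second countability reduces the claim to countably many charts. The Hessian in the
definition of a Morse function is taken in the preferred chart at each point, so it has to be compared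
with the Hessian in the countably many charts of the cover; at a critical point the two
differ by an invertible linear substitution (`fderiv_fderiv_comp_apply`,
`exists_degenerate_direction_of_not_hasNondegenerateHessian`).
-/

open Set Filter Topology MeasureTheory

/-! ### Degenerate zeros of affine families of equations -/

/-- Parametric Sard theorem for a family of equations affine in the parameter `a`, with as many
unknowns as equations: for almost every `a`, all zeros of `G x + T x a` near `x₀` are nondegenerate.
Only the equidimensional Sard theorem is needed, since the pairs `(x, a)` with `G x + T x a = 0` are
parametrised by an open subset of the parameter space itself. -/
theorem exists_nhds_measure_degenerate_zeros_eq_zero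
    {X Y P : Type*} [NormedAddCommGroup X] [NormedSpace ℝ X] [FiniteDimensional ℝ X]
    [NormedAddCommGroup Y] [NormedSpace ℝ Y] [FiniteDimensional ℝ Y]
    [NormedAddCommGroup P] [NormedSpace ℝ P] [FiniteDimensional ℝ P]
    [MeasurableSpace P] [BorelSpace P] (μ : Measure P) [μ.IsAddHaarMeasure]
    (hXY : Module.finrank ℝ X = Module.finrank ℝ Y)
    {G : X → Y} {T : X → P →L[ℝ] Y} {x₀ : X}
    (hG : ContDiffAt ℝ 1 G x₀) (hT : ContDiffAt ℝ 1 T x₀)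
    (hsurj : Function.Surjective (T x₀)) :
    ∃ V ∈ 𝓝 x₀, μ {a | ∃ x ∈ V, G x + T x a = 0 ∧
      ∃ v ≠ 0, fderiv ℝ (fun x => G x + T x a) x v = 0} = 0 := by
  obtain ⟨S, hS⟩ := (T x₀).exists_rightInverse_of_surjective
    (LinearMap.range_eq_top.2 hsurj)
  have hS' : ∀ y, T x₀ (S y) = y := fun y => congr($hS y)
  let e : Y ≃L[ℝ] X := ContinuousLinearEquiv.ofFinrankEq hXY.symm
  -- near `x₀`, the endomorphism `T x ∘ S` of `Y` is invertible
  have hunit : ∀ᶠ x in 𝓝 x₀, IsUnit ((T x).comp S) := by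
    have hc : ContinuousAt (fun x => (T x).comp S) x₀ :=
      hT.continuousAt.clm_comp continuousAt_const
    refine hc.eventually_mem (Units.isOpen.mem_nhds ?_)
    change IsUnit ((T x₀).comp S)
    rw [hS]
    exact isUnit_one
  have hGd : ∀ᶠ x in 𝓝 x₀, DifferentiableAt ℝ G x :=
    (hG.eventually (by simp)).mono fun x hx => hx.differentiableAt (by simp)
  have hTd : ∀ᶠ x in 𝓝 x₀, DifferentiableAt ℝ T x :=
    (hT.eventually (by simp)).mono fun x hx => hx.differentiableAt (by simp)
  refine ⟨_, hunit.and (hGd.and hTd), ?_⟩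
  -- A point `p : P` encodes the pair `(ξ p, γ p)` with `ξ p` an unknown and `γ p ∈ ker (T x₀)`;
  -- `Ψ p` is the solution `a` of `G (ξ p) + T (ξ p) a = 0` with `ker (T x₀)`-component `γ p`.
  let ξ : P →L[ℝ] X := (e : Y →L[ℝ] X).comp (T x₀)
  let γ : P →L[ℝ] P := ContinuousLinearMap.id ℝ P - S.comp (T x₀)
  let Ψ : P → P := fun p =>
    γ p - S (Ring.inverse ((T (ξ p)).comp S) (G (ξ p) + T (ξ p) (γ p)))
  let Z : Set P := {p | (IsUnit ((T (ξ p)).comp S) ∧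
    DifferentiableAt ℝ G (ξ p) ∧ DifferentiableAt ℝ T (ξ p)) ∧
    ∃ w ≠ 0, fderiv ℝ Ψ p w = 0}
  have hΨ : ∀ p, IsUnit ((T (ξ p)).comp S) → DifferentiableAt ℝ G (ξ p) →
      DifferentiableAt ℝ T (ξ p) → DifferentiableAt ℝ Ψ p := by
    intro p hu hg ht
    have hg' : DifferentiableAt ℝ (fun p => G (ξ p)) p := hg.comp p ξ.differentiableAt
    have ht' : DifferentiableAt ℝ (fun p => T (ξ p)) p := ht.comp p ξ.differentiableAt
    have hi : DifferentiableAt ℝ (fun p => Ring.inverse ((T (ξ p)).comp S)) p :=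
      (differentiableAt_inverse (𝕜 := ℝ) hu).comp p
        (f := fun p => (T (ξ p)).comp S) (ht'.clm_comp (differentiableAt_const S))
    exact γ.differentiableAt.sub (S.differentiableAt.comp p
      (hi.clm_apply (hg'.add (ht'.clm_apply γ.differentiableAt))))
  have hnull : μ (Ψ '' Z) = 0 := by
    refine addHaar_image_eq_zero_of_det_fderivWithin_eq_zero μ (f' := fderiv ℝ Ψ) ?_ ?_
    · rintro p ⟨⟨hu, hg, ht⟩, -⟩
      exact (hΨ p hu hg ht).hasFDerivAt.hasFDerivWithinAt
    · rintro p ⟨-, w, hw, hw0⟩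
      by_contra hdet
      exact hw ((ContinuousLinearMap.toContinuousLinearEquivOfDetNeZero _ hdet).injective
        (by simpa using hw0))
  refine measure_mono_null ?_ hnull
  rintro a ⟨x, ⟨hu, hg, ht⟩, hzero, v, hv, hdv⟩
  -- `ξ p = x`, and `γ p` is the component of `a` in `ker (T x₀)`
  let p : P := S (e.symm x) + γ a
  have hTγ : ∀ b, T x₀ (γ b) = 0 := fun b => by simp [γ, hS']
  have hξp : ξ p = x := by simp [ξ, p, hTγ, hS']
  have hγp : γ p = γ a := by simp [γ, p, hS']
  have hinv : ∀ y, Ring.inverse ((T x).comp S) (T x (S y)) = y := fun y =>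
    congr($(Ring.inverse_mul_cancel _ hu) y)
  have ha : γ a + S (T x₀ a) = a := by simp [γ]
  have hΨp : Ψ p = a := by
    have : G x + T x (γ a) = T x (S (-(T x₀ a))) := by
      rw [← ha, map_add, ← add_assoc] at hzero
      rw [map_neg, map_neg]
      exact eq_neg_of_add_eq_zero_left hzero
    simp only [Ψ, hξp, hγp]
    rw [this, hinv, map_neg, sub_neg_eq_add, ha]
  refine ⟨p, ⟨by rw [hξp]; exact ⟨hu, hg, ht⟩, S (e.symm v), ?_, ?_⟩, hΨp⟩
  · intro h
    apply hv
    have := hS' (e.symm v)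
    rw [h, map_zero] at this
    simpa using this.symm
  have hΨd : DifferentiableAt ℝ Ψ p := hΨ p (by rwa [hξp]) (by rwa [hξp]) (by rwa [hξp])
  set w : P := S (e.symm v)
  have hξw : ξ w = v := by simp [ξ, w, hS']
  have hγS : ∀ y, γ (S y) = 0 := fun y => by simp [γ, hS']
  -- differentiating `γ (Ψ q) = γ q` shows that `Ψ' w` lies in the range of `S`
  have hγΨ : γ (fderiv ℝ Ψ p w) = 0 := by
    have h1 : (fun q => γ (Ψ q)) = γ := by
      ext q
      have : γ (γ q) = γ q := by simp [γ, hS']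
      simp only [Ψ, map_sub, hγS, this, sub_zero]
    have h2 : HasFDerivAt (fun q => γ (Ψ q)) (γ.comp (fderiv ℝ Ψ p)) p :=
      γ.hasFDerivAt.comp p hΨd.hasFDerivAt
    rw [h1] at h2
    have h3 := congr($(h2.unique γ.hasFDerivAt) w)
    simpa [w, hγS] using h3
  -- differentiating `G (ξ q) + T (ξ q) (Ψ q) = 0` shows that `T x (Ψ' w) = 0`
  have hTΨ : T x (fderiv ℝ Ψ p w) = 0 := by
    have hev : (fun q => G (ξ q) + T (ξ q) (Ψ q)) =ᶠ[𝓝 p] fun _ => 0 := by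
      have hu' : ∀ᶠ q in 𝓝 p, IsUnit ((T (ξ q)).comp S) := by
        have hTc : ContinuousAt (fun q => (T (ξ q)).comp S) p := by
          refine ContinuousAt.clm_comp (ContinuousAt.comp (g := T) ?_ ξ.continuous.continuousAt)
            continuousAt_const
          rw [hξp]
          exact ht.continuousAt
        refine hTc.eventually_mem (Units.isOpen.mem_nhds ?_)
        change IsUnit ((T (ξ p)).comp S)
        rwa [hξp]
      filter_upwards [hu'] with q hq
      have : ∀ y, T (ξ q) (S (Ring.inverse ((T (ξ q)).comp S) y)) = y := fun y =>
        congr($(Ring.mul_inverse_cancel _ hq) y)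
      simp only [Ψ, map_sub, this]
      abel
    have hg1 : HasFDerivAt (fun q => G (ξ q)) ((fderiv ℝ G x).comp ξ) p :=
      HasFDerivAt.comp p (by rw [hξp]; exact hg.hasFDerivAt) ξ.hasFDerivAt
    have ht1 : HasFDerivAt (fun q => T (ξ q)) ((fderiv ℝ T x).comp ξ) p :=
      HasFDerivAt.comp p (by rw [hξp]; exact ht.hasFDerivAt) ξ.hasFDerivAt
    have h1 := (hg1.add (ht1.clm_apply hΨd.hasFDerivAt)).congr_of_eventuallyEq hev.symm
    have h2 := congr($(h1.unique (hasFDerivAt_const 0 p)) w)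
    have h3 := (hg.hasFDerivAt.add (ht.hasFDerivAt.clm_apply (hasFDerivAt_const a x))).fderiv
    have h4 : fderiv ℝ (fun x => G x + T x a) x v = fderiv ℝ G x v + fderiv ℝ T x v a := by
      refine congr($h3 v).trans ?_
      simp
    rw [h4] at hdv
    simp only [hξp, hΨp, add_apply, ContinuousLinearMap.comp_apply,
      ContinuousLinearMap.flip_apply, hξw, zero_apply] at h2
    rw [add_left_comm, hdv, add_zero] at h2
    exact h2
  have hd : fderiv ℝ Ψ p w = S (T x₀ (fderiv ℝ Ψ p w)) := by
    simpa [γ, sub_eq_zero] using hγΨ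
  rw [hd] at hTΨ
  have h0 := hinv (T x₀ (fderiv ℝ Ψ p w))
  rw [hTΨ, map_zero] at h0
  rw [hd, ← h0, map_zero]

/-! ### Second derivatives at critical points -/

/-- At a critical point of `k`, the term of the second-order chain rule that contains the second
derivative of `τ` vanishes, so the Hessian transforms as a bilinear form. -/
theorem fderiv_fderiv_comp_apply
    {X X' : Type*} [NormedAddCommGroup X] [NormedSpace ℝ X]
    [NormedAddCommGroup X'] [NormedSpace ℝ X'] {k : X' → ℝ} {τ : X → X'} {y : X}
    (hk : ContDiffAt ℝ 2 k (τ y)) (hτ : ContDiffAt ℝ 2 τ y) (hcrit : fderiv ℝ k (τ y) = 0)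
    (v : X) :
    fderiv ℝ (fderiv ℝ (k ∘ τ)) y v =
      (fderiv ℝ (fderiv ℝ k) (τ y) (fderiv ℝ τ y v)).comp (fderiv ℝ τ y) := by
  have hk1 : ∀ᶠ z in 𝓝 y, DifferentiableAt ℝ k (τ z) :=
    hτ.continuousAt.eventually
      ((hk.eventually (by simp)).mono fun x hx => hx.differentiableAt (by simp))
  have hτ1 : ∀ᶠ z in 𝓝 y, DifferentiableAt ℝ τ z :=
    (hτ.eventually (by simp)).mono fun x hx => hx.differentiableAt (by simp)
  have hev : fderiv ℝ (k ∘ τ) =ᶠ[𝓝 y] fun z => (fderiv ℝ k (τ z)).comp (fderiv ℝ τ z) := by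
    filter_upwards [hk1, hτ1] with z hz1 hz2 using fderiv_comp z hz1 hz2
  have hk2 : DifferentiableAt ℝ (fderiv ℝ k) (τ y) :=
    (hk.fderiv_right (m := 1) (by norm_num)).differentiableAt (by simp)
  have hτ2 : DifferentiableAt ℝ (fderiv ℝ τ) y :=
    (hτ.fderiv_right (m := 1) (by norm_num)).differentiableAt (by simp)
  have h1 : HasFDerivAt (fun z => fderiv ℝ k (τ z))
      ((fderiv ℝ (fderiv ℝ k) (τ y)).comp (fderiv ℝ τ y)) y :=
    hk2.hasFDerivAt.comp y (hτ.differentiableAt (by simp)).hasFDerivAt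
  rw [hev.fderiv_eq, (h1.clm_comp hτ2.hasFDerivAt).fderiv]
  ext w
  simp [hcrit]

/-- Local form of the theorem: near a point where `g` is an immersion, almost every perturbation of
`φ` by a linear form in `g` has only nondegenerate critical points. The equivalence `C` identifies
the parameters with the linear forms. -/
theorem exists_nhds_measure_degenerate_critical_eq_zero
    {X M P : Type*} [NormedAddCommGroup X] [NormedSpace ℝ X] [FiniteDimensional ℝ X]
    [NormedAddCommGroup M] [NormedSpace ℝ M] [FiniteDimensional ℝ M]
    [NormedAddCommGroup P] [NormedSpace ℝ P] [FiniteDimensional ℝ P]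
    [MeasurableSpace P] [BorelSpace P] (μ : Measure P) [μ.IsAddHaarMeasure]
    {φ : X → ℝ} {g : X → M} {x₀ : X} (C : P ≃L[ℝ] (M →L[ℝ] ℝ))
    (hφ : ContDiffAt ℝ 2 φ x₀) (hg : ContDiffAt ℝ 2 g x₀)
    (hinj : Function.Injective (fderiv ℝ g x₀)) :
    ∃ V ∈ 𝓝 x₀, μ {a | ∃ x ∈ V, fderiv ℝ (fun z => φ z + C a (g z)) x = 0 ∧
      ∃ v ≠ 0, fderiv ℝ (fderiv ℝ (fun z => φ z + C a (g z))) x v = 0} = 0 := by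
  let T : X → P →L[ℝ] (X →L[ℝ] ℝ) := fun x =>
    ((ContinuousLinearMap.compL ℝ X M ℝ).flip (fderiv ℝ g x)).comp (C : P →L[ℝ] (M →L[ℝ] ℝ))
  have hT : ContDiffAt ℝ 1 T x₀ :=
    ((ContinuousLinearMap.contDiff _).contDiffAt.comp x₀
      (hg.fderiv_right (m := 1) (by norm_num))).clm_comp contDiffAt_const
  have hsurj : Function.Surjective (T x₀) := by
    intro l
    obtain ⟨r, hr⟩ := (fderiv ℝ g x₀).toLinearMap.exists_leftInverse_of_injective
      (LinearMap.ker_eq_bot.2 hinj)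
    refine ⟨C.symm (l.comp (LinearMap.toContinuousLinearMap r)), ?_⟩
    ext v
    have : r (fderiv ℝ g x₀ v) = v := congr($hr v)
    simp [T, this]
  obtain ⟨V, hV, hnull⟩ := exists_nhds_measure_degenerate_zeros_eq_zero μ
    ((Subspace.dual_finrank_eq (K := ℝ) (V := X)).symm.trans
      (LinearMap.toContinuousLinearMap : (X →ₗ[ℝ] ℝ) ≃ₗ[ℝ] X →L[ℝ] ℝ).finrank_eq)
    (hφ.fderiv_right (m := 1) (by norm_num)) hT hsurj
  have hφ1 : ∀ᶠ x in 𝓝 x₀, DifferentiableAt ℝ φ x :=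
    (hφ.eventually (by simp)).mono fun x hx => hx.differentiableAt (by simp)
  have hg1 : ∀ᶠ x in 𝓝 x₀, DifferentiableAt ℝ g x :=
    (hg.eventually (by simp)).mono fun x hx => hx.differentiableAt (by simp)
  have hfd : ∀ᶠ x in 𝓝 x₀, ∀ a,
      fderiv ℝ (fun z => φ z + C a (g z)) x = fderiv ℝ φ x + T x a := by
    filter_upwards [hφ1, hg1] with x hx1 hx2 a
    exact (hx1.hasFDerivAt.add ((C a).hasFDerivAt.comp x hx2.hasFDerivAt)).fderiv
  refine ⟨_, hfd.eventually_nhds.and hV, measure_mono_null ?_ hnull⟩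
  rintro a ⟨x, ⟨hx, hxV⟩, hcrit, v, hv, hdeg⟩
  have hev : fderiv ℝ (fun z => φ z + C a (g z)) =ᶠ[𝓝 x] fun z => fderiv ℝ φ z + T z a :=
    hx.mono fun z hz => hz a
  refine ⟨x, hxV, hev.eq_of_nhds ▸ hcrit, v, hv, ?_⟩
  rw [← hev.fderiv_eq]
  exact hdeg

/-! ### Injectivity of differentials -/

theorem mdifferentiable_of_mem_maximalAtlas {E H M : Type*} [NormedAddCommGroup E]
    [NormedSpace ℝ E] [TopologicalSpace H] {I : ModelWithCorners ℝ E H} [TopologicalSpace M]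
    [ChartedSpace H M] {e : OpenPartialHomeomorph M H} (he : e ∈ IsManifold.maximalAtlas I 1 M) :
    e.MDifferentiable I I :=
  ⟨(contMDiffOn_of_mem_maximalAtlas he).mdifferentiableOn one_ne_zero,
    (contMDiffOn_symm_of_mem_maximalAtlas he).mdifferentiableOn one_ne_zero⟩

/-- In suitable charts an immersion is `u ↦ (u, 0)`, which has the first projection as a left
inverse; hence the differential is injective. -/
theorem Manifold.IsImmersionAt.mfderiv_injective {E E' M M' : Type*}
    [NormedAddCommGroup E] [NormedSpace ℝ E] [NormedAddCommGroup E'] [NormedSpace ℝ E']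
    [TopologicalSpace M] [ChartedSpace E M] [TopologicalSpace M'] [ChartedSpace E' M']
    {n : ℕ∞ω} (hn : 1 ≤ n) [IsManifold 𝓘(ℝ, E) 1 M] [IsManifold 𝓘(ℝ, E') 1 M']
    {f : M → M'} {x : M} (h : IsImmersionAt 𝓘(ℝ, E) 𝓘(ℝ, E') n f x) :
    Function.Injective (mfderiv 𝓘(ℝ, E) 𝓘(ℝ, E') f x) := by
  have hd := mdifferentiable_of_mem_maximalAtlas
    (IsManifold.maximalAtlas_subset_of_le hn h.domChart_mem_maximalAtlas)
  have hc := mdifferentiable_of_mem_maximalAtlas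
    (IsManifold.maximalAtlas_subset_of_le hn h.codChart_mem_maximalAtlas)
  have hf : MDifferentiableAt 𝓘(ℝ, E) 𝓘(ℝ, E') f x :=
    h.contMDiffAt.mdifferentiableAt (by rintro rfl; simp at hn)
  let l : E' →L[ℝ] E := (ContinuousLinearMap.fst ℝ E h.complement).comp
    (h.equiv.symm : E' →L[ℝ] E × h.complement)
  have hl : MDifferentiableAt 𝓘(ℝ, E') 𝓘(ℝ, E) (l ∘ h.codChart) (f x) :=
    l.differentiableAt.mdifferentiableAt.comp (f x) (hc.mdifferentiableAt h.mem_codChart_source)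
  have hev : (l ∘ h.codChart) ∘ f =ᶠ[𝓝 x] h.domChart := by
    filter_upwards [h.domChart.open_source.mem_nhds h.mem_domChart_source] with y hy
    have hm : h.domChart y ∈ (h.domChart.extend 𝓘(ℝ, E)).target :=
      (h.domChart.extend 𝓘(ℝ, E)).map_source (by rwa [OpenPartialHomeomorph.extend_source])
    have hw : h.codChart (f y) = h.equiv (h.domChart y, 0) := by
      have := h.writtenInCharts hm
      rw [Function.comp_apply, Function.comp_apply, Function.comp_apply] at this
      simpa [h.domChart.left_inv hy] using this
    simp [l, hw]
  have hinj := hd.mfderiv_injective h.mem_domChart_source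
  rw [← hev.mfderiv_eq, mfderiv_comp x hl hf] at hinj
  exact Function.Injective.of_comp hinj

theorem mfderiv_subtype_val_injective {E M : Type*} [NormedAddCommGroup E] [NormedSpace ℝ E]
    [TopologicalSpace M] [ChartedSpace E M]
    {U : TopologicalSpace.Opens M} (x : U) :
    Function.Injective (mfderiv 𝓘(ℝ, E) 𝓘(ℝ, E) (Subtype.val : U → M) x) := by
  have : Nonempty U := ⟨x⟩
  -- `r` takes arbitrary values off `U`, but only its germ at points of `U` matters
  let r : M → U := Function.invFun Subtype.val
  have hr : r ∘ (Subtype.val : U → M) = id :=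
    funext (Function.leftInverse_invFun Subtype.val_injective)
  have hrd : MDifferentiableAt 𝓘(ℝ, E) 𝓘(ℝ, E) r x.1 := by
    refine ContMDiffAt.mdifferentiableAt (n := 1) ?_ one_ne_zero
    rw [← contMDiffAt_subtype_iff]
    change ContMDiffAt 𝓘(ℝ, E) 𝓘(ℝ, E) 1 (r ∘ (Subtype.val : U → M)) x
    rw [hr]
    exact contMDiffAt_id
  have hv : MDifferentiableAt 𝓘(ℝ, E) 𝓘(ℝ, E) (Subtype.val : U → M) x :=
    (contMDiff_subtype_val (n := 1)).mdifferentiableAt one_ne_zero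
  have h := mfderiv_comp x hrd hv
  rw [hr, mfderiv_id] at h
  intro v w hvw
  have hc := fun v => congr($h v)
  exact (hc v).trans ((congrArg (mfderiv 𝓘(ℝ, E) 𝓘(ℝ, E) r x.1) hvw).trans (hc w).symm)

/-! ### Functions read in charts -/

section Charts

variable {E N M : Type*} [NormedAddCommGroup E] [NormedSpace ℝ E]
  [NormedAddCommGroup M] [NormedSpace ℝ M] [TopologicalSpace N] [ChartedSpace E N]
  {k : N → M} {c : OpenPartialHomeomorph N E} {q : N}

theorem ContMDiff.contDiffAt_comp_symm (hk : ContMDiff 𝓘(ℝ, E) 𝓘(ℝ, M) ∞ k)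
    (hc : c ∈ IsManifold.maximalAtlas 𝓘(ℝ, E) ∞ N) (hq : q ∈ c.source) :
    ContDiffAt ℝ ∞ (k ∘ c.symm) (c q) :=
  (hk.contMDiffAt.comp (c q) ((contMDiffOn_symm_of_mem_maximalAtlas hc).contMDiffAt
    (c.open_target.mem_nhds (c.map_source hq)))).contDiffAt

theorem ContMDiff.fderiv_comp_symm_apply (hk : ContMDiff 𝓘(ℝ, E) 𝓘(ℝ, M) ∞ k)
    (hc : c ∈ IsManifold.maximalAtlas 𝓘(ℝ, E) ∞ N) {x : E} (hx : x ∈ c.target) (v : E) :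
    fderiv ℝ (k ∘ c.symm) x v =
      mfderiv 𝓘(ℝ, E) 𝓘(ℝ, M) k (c.symm x) (mfderiv 𝓘(ℝ, E) 𝓘(ℝ, E) c.symm x v) := by
  have hd := mdifferentiable_of_mem_maximalAtlas
    (IsManifold.maximalAtlas_subset_of_le (m := 1) (by simp) hc)
  rw [← mfderiv_eq_fderiv]
  exact mfderiv_comp_apply x (hk.mdifferentiableAt (by simp)) (hd.mdifferentiableAt_symm hx) v

theorem ContMDiff.injective_fderiv_comp_symm [IsManifold 𝓘(ℝ, E) ∞ N]
    (hk : ContMDiff 𝓘(ℝ, E) 𝓘(ℝ, M) ∞ k)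
    (hc : c ∈ IsManifold.maximalAtlas 𝓘(ℝ, E) ∞ N) {x : E} (hx : x ∈ c.target)
    (hinj : Function.Injective (mfderiv 𝓘(ℝ, E) 𝓘(ℝ, M) k (c.symm x))) :
    Function.Injective (fderiv ℝ (k ∘ c.symm) x) := by
  have hd := mdifferentiable_of_mem_maximalAtlas
    (IsManifold.maximalAtlas_subset_of_le (m := 1) (by simp) hc)
  have hs := hd.symm.mfderiv_injective (x := x) hx
  intro v w hvw
  rw [hk.fderiv_comp_symm_apply hc hx, hk.fderiv_comp_symm_apply hc hx] at hvw
  exact hs (hinj hvw)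

end Charts

section Hessian

variable {n : ℕ} {N : Type*} [TopologicalSpace N] [ChartedSpace (EuclideanSpace ℝ (Fin n)) N]
  [IsManifold (𝓡 n) ∞ N] {h : N → ℝ} {q : N}

/-- Degeneracy of a singular point, defined through the preferred chart, is visible in every chart
of the maximal atlas. -/
theorem exists_degenerate_direction_of_not_hasNondegenerateHessian
    (hh : ContMDiff (𝓡 n) 𝓘(ℝ, ℝ) ∞ h) (hq : IsSingularPoint (n := n) h q)
    (hdeg : ¬ HasNondegenerateHessian (n := n) h q)
    {c : OpenPartialHomeomorph N (EuclideanSpace ℝ (Fin n))}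
    (hc : c ∈ IsManifold.maximalAtlas (𝓡 n) ∞ N) (hqc : q ∈ c.source) :
    fderiv ℝ (h ∘ c.symm) (c q) = 0 ∧
      ∃ v ≠ 0, fderiv ℝ (fderiv ℝ (h ∘ c.symm)) (c q) v = 0 := by
  have hcrit : fderiv ℝ (h ∘ c.symm) (c q) = 0 := by
    ext v
    have hq' : mfderiv (𝓡 n) 𝓘(ℝ, ℝ) h (c.symm (c q)) = 0 := by
      rw [c.left_inv hqc]
      exact hq
    rw [hh.fderiv_comp_symm_apply hc (c.map_source hqc), hq']
    rfl
  refine ⟨hcrit, ?_⟩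
  let c' := chartAt (EuclideanSpace ℝ (Fin n)) q
  have hc' : c' ∈ IsManifold.maximalAtlas (𝓡 n) ∞ N := IsManifold.chart_mem_maximalAtlas q
  have hqc' : q ∈ c'.source := mem_chart_source _ q
  let τ : EuclideanSpace ℝ (Fin n) → EuclideanSpace ℝ (Fin n) := c ∘ c'.symm
  have hτq : τ (c' q) = c q := by simp [τ, c'.left_inv hqc']
  have hd := mdifferentiable_of_mem_maximalAtlas
    (IsManifold.maximalAtlas_subset_of_le (m := 1) (by simp) hc)
  have hd' := mdifferentiable_of_mem_maximalAtlas
    (IsManifold.maximalAtlas_subset_of_le (m := 1) (by simp) hc')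
  have hsymm : c'.symm (c' q) = q := c'.left_inv hqc'
  have hτ : ContDiffAt ℝ ∞ τ (c' q) := by
    refine ContMDiffAt.contDiffAt (ContMDiffAt.comp (c' q) (I' := 𝓡 n) ?_
      ((contMDiffOn_symm_of_mem_maximalAtlas hc').contMDiffAt
        (c'.open_target.mem_nhds (c'.map_source hqc'))))
    rw [hsymm]
    exact (contMDiffOn_of_mem_maximalAtlas hc).contMDiffAt (c.open_source.mem_nhds hqc)
  have hinj : Function.Injective (fderiv ℝ τ (c' q)) := by
    have h1 := hd'.symm.mfderiv_injective (x := c' q) (c'.map_source hqc')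
    have h2 := hd.mfderiv_injective (x := c'.symm (c' q)) (by rwa [hsymm])
    have h3 := mfderiv_comp (c' q) (hd.mdifferentiableAt (x := c'.symm (c' q)) (by rwa [hsymm]))
      (hd'.mdifferentiableAt_symm (c'.map_source hqc'))
    rw [← mfderiv_eq_fderiv, show τ = c ∘ c'.symm from rfl, h3]
    exact h2.comp h1
  have hev : h ∘ c'.symm =ᶠ[𝓝 (c' q)] (h ∘ c.symm) ∘ τ := by
    have : ∀ᶠ z in 𝓝 (c' q), c'.symm z ∈ c.source := by
      refine (c'.symm.continuousAt (c'.map_source hqc')).eventually_mem ?_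
      rw [hsymm]
      exact c.open_source.mem_nhds hqc
    filter_upwards [this] with z hz
    simp [τ, c.left_inv hz]
  simp only [HasNondegenerateHessian, not_forall] at hdeg
  obtain ⟨v, hv, hv0⟩ := hdeg
  refine ⟨fderiv ℝ τ (c' q) v, fun h0 => hv0 (hinj (h0.trans (map_zero _).symm)), ?_⟩
  have hk : ContDiffAt ℝ 2 (h ∘ c.symm) (τ (c' q)) := by
    rw [hτq]
    exact (hh.contDiffAt_comp_symm hc hqc).of_le (WithTop.coe_le_coe.2 le_top)
  have hcomp := fderiv_fderiv_comp_apply hk (hτ.of_le (WithTop.coe_le_coe.2 le_top))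
    (by rwa [hτq]) v
  have hH : chartHessian h q v = fderiv ℝ (fderiv ℝ ((h ∘ c.symm) ∘ τ)) (c' q) v := by
    rw [← hev.fderiv.fderiv_eq]
    rfl
  ext u
  obtain ⟨w, rfl⟩ := (LinearMap.injective_iff_surjective
    (f := (fderiv ℝ τ (c' q)).toLinearMap)).1 hinj u
  have := hv w
  rw [hH, hcomp, hτq] at this
  exact this

end Hessian

/-! ### Genericity of Morse functions -/

theorem corollary5p1 (n m : ℕ) {N : Type*} [TopologicalSpace N] [T2Space N]
    [SecondCountableTopology N] [ChartedSpace (EuclideanSpace ℝ (Fin n)) N]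
    [IsManifold (𝓡 n) ∞ N]
    (U : TopologicalSpace.Opens (EuclideanSpace ℝ (Fin m)))
    (f : N → U) (hf : Manifold.IsImmersion (𝓡 n) (𝓡 m) ∞ f)
    (F : U → ℝ) (hF : ContMDiff (𝓡 m) 𝓘(ℝ, ℝ) ∞ F) :
    ∃ S : Set (EuclideanSpace ℝ (Fin m) →ₗ[ℝ] ℝ), HasLebesgueMeasureZero S ∧
      ∀ π : EuclideanSpace ℝ (Fin m) →ₗ[ℝ] ℝ, π ∉ S →
        IsMorseFunction n (linearPerturbation F π ∘ f) := by
  have : IsManifold (𝓡 n) 1 N := IsManifold.of_le (n := ∞) (by simp)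
  let g : N → EuclideanSpace ℝ (Fin m) := Subtype.val ∘ f
  have hg : ContMDiff (𝓡 n) (𝓡 m) ∞ g := contMDiff_subtype_val.comp hf.contMDiff
  have hFf : ContMDiff (𝓡 n) 𝓘(ℝ, ℝ) ∞ (F ∘ f) := hF.comp hf.contMDiff
  have hginj : ∀ q, Function.Injective (mfderiv (𝓡 n) (𝓡 m) g q) := by
    intro q
    have h1 := (hf.isImmersionAt q).mfderiv_injective (by simp)
    have h2 := mfderiv_subtype_val_injective (E := EuclideanSpace ℝ (Fin m)) (f q)
    rw [mfderiv_comp q ((contMDiff_subtype_val (I := 𝓡 m) (n := 1)).mdifferentiableAt one_ne_zero)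
      (hf.contMDiff.mdifferentiableAt (by simp))]
    exact h2.comp h1
  let C : (Fin m → ℝ) ≃L[ℝ] (EuclideanSpace ℝ (Fin m) →L[ℝ] ℝ) :=
    ((coeffEquiv m).symm.trans LinearMap.toContinuousLinearMap).toContinuousLinearEquiv
  have hC : ∀ π x, C (coeffEquiv m π) x = π x := fun π x => by simp [C]
  have hpert : ∀ π, linearPerturbation F π ∘ f = fun q => F (f q) + C (coeffEquiv m π) (g q) :=
    fun π => funext fun q => by rw [hC]; rfl
  have hsmooth : ∀ π, ContMDiff (𝓡 n) 𝓘(ℝ, ℝ) ∞ (linearPerturbation F π ∘ f) := fun π => by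
    rw [hpert]
    exact hFf.add ((C (coeffEquiv m π)).contMDiff.comp hg)
  let c : N → OpenPartialHomeomorph N (EuclideanSpace ℝ (Fin n)) := chartAt (EuclideanSpace ℝ (Fin n))
  have hc : ∀ q, c q ∈ IsManifold.maximalAtlas (𝓡 n) ∞ N :=
    fun q => IsManifold.chart_mem_maximalAtlas q
  have hqc : ∀ q, q ∈ (c q).source := fun q => mem_chart_source _ q
  have hloc := fun q => exists_nhds_measure_degenerate_critical_eq_zero
    (volume : Measure (Fin m → ℝ)) C
    ((hFf.contDiffAt_comp_symm (hc q) (hqc q)).of_le (m := 2) (WithTop.coe_le_coe.2 le_top))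
    ((hg.contDiffAt_comp_symm (hc q) (hqc q)).of_le (m := 2) (WithTop.coe_le_coe.2 le_top))
    (hg.injective_fderiv_comp_symm (hc q) ((c q).map_source (hqc q)) (hginj _))
  choose V hV hnull using hloc
  obtain ⟨s, hs, hcover⟩ := TopologicalSpace.countable_cover_nhds
    (f := fun q => (c q).source ∩ c q ⁻¹' V q) fun q =>
      inter_mem ((c q).open_source.mem_nhds (hqc q)) ((c q).continuousAt (hqc q) (hV q))
  refine ⟨coeffEquiv m ⁻¹' ⋃ q ∈ s, _, measure_mono_null (image_preimage_subset _ _)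
    ((measure_biUnion_null_iff hs).2 fun q _ => hnull q), fun π hπ => ⟨hsmooth π, ?_⟩⟩
  intro q hq
  by_contra hdeg
  obtain ⟨q₀, hq₀, hqs, hqV⟩ : ∃ q₀ ∈ s, q ∈ (c q₀).source ∧ c q₀ q ∈ V q₀ := by
    have : q ∈ ⋃ x ∈ s, (c x).source ∩ c x ⁻¹' V x := hcover ▸ mem_univ q
    simpa only [mem_iUnion, exists_prop, mem_inter_iff, mem_preimage] using this
  refine hπ (mem_iUnion₂.2 ⟨q₀, hq₀, c q₀ q, hqV, ?_⟩)
  have := exists_degenerate_direction_of_not_hasNondegenerateHessian (hsmooth π) hq hdeg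
    (hc q₀) hqs
  rw [hpert] at this
  exact this
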